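/- Let $E$ be a (real) Banach lattice with positive cone $E^+$ and topological dual $E'$; let $(E')^+$ be the set of positive functionals in $E'$. A net $(x_\alpha)$ in $E$ is uaw-convergent to $x\in E$ if $|x_\alpha-x|\wedge w\to 0$ weakly for every $w\in E^+$, and uaw-null if it is uaw-convergent to $0$. A norm bounded set $A\subset E$ is uaw-compact (resp. relatively uaw-compact) if every net in $A$ has a subnet that is uaw-convergent to an element of $A$ (resp. of $E$). For $A\subset E$ let $\mathrm{sol}(A)=\{x\in E:\ |x|\le |y| \text{ for some } y\in A\}$. A norm bounded set $A\subset E$ is L-weakly compact if every disjoint sequence in $\mathrm{sol}(A)$ is norm null. For a norm bounded set $\mathcal S\subset E$, a bounded operator $T$ from $E$ to a Banach space is $\mathcal S$-L-weakly compact if $\|Tx_n\|\to0$ for every uaw-null sequence $(x_n)$ in $\mathrm{sol}(\mathcal S)$. Finally, $E$ is order continuous if every decreasing net in $E$ with infimum $0$ is norm null. The following statements are equivalent: 1. $E$ is order continuous. 2. Every relatively compact subset of $E$ is L-weakly compact. 3. For every $v\in E^+$, the identity operator $\mathrm{Id}_E$ is $\{v\}$-L-weakly compact. 4. For every $\varepsilon>0$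 and $v\in E^+$ there exist $g\in (E')^+$ and $w\in E^+$ such that $\|x\|\le g(|x|\wedge w)+\varepsilon$ for all $x\in[-v,v]$. 5. For every $v\in E^+$, every uaw-null net in $[-v,v]$ is norm null. 6. For every $v\in E^+$, every uaw-null sequence in $[-v,v]$ is norm null. 7. Every order bounded uaw-compact subset of $E$ is compact. 8. Every order bounded relatively uaw-compact subset of $E$ is relatively compact. -/

import Mathlib

open Filter Topology

universe u

section UAWDefinitions

universe v

/-- Order continuity of a Banach lattice: every net decreasing to `0` (decreasing, with infimum
`0`) is norm null. The index sets range over the universe of `E`; since only the decreasing,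
downward directed set of values matters, this covers all nets. -/
def IsOrderContinuousLattice (E : Type u) [NormedAddCommGroup E] [Lattice E] : Prop :=
  ∀ (ι : Type u) [Preorder ι] [IsDirectedOrder ι] [Nonempty ι] (x : ι → E),
    Antitone x → IsGLB (Set.range x) 0 → Tendsto x atTop (𝓝 0)

variable {E : Type u} [NormedAddCommGroup E] [NormedSpace ℝ E] [Lattice E]

/-- Unbounded absolute weak convergence of the net `x` to `a`: for every `w ≥ 0`, the net
`|x i - a| ⊓ w` converges weakly to `0`, i.e. tested against every continuous functional. -/
def UAWTendsto {ι : Type v} [Preorder ι] (x : ι → E) (a : E) : Prop :=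
  ∀ w : E, 0 ≤ w → ∀ f : StrongDual ℝ E, Tendsto (fun i => f (|x i - a| ⊓ w)) atTop (𝓝 0)

/-- `A` is L-weakly compact: it is norm bounded and every disjoint sequence in its solid hull is
norm null. -/
def IsLWeaklyCompact (A : Set E) : Prop :=
  Bornology.IsBounded A ∧
    ∀ x : ℕ → E, (∀ n, x n ∈ LatticeOrderedAddCommGroup.solidClosure A) →
      (∀ m n, m ≠ n → |x m| ⊓ |x n| = 0) → Tendsto x atTop (𝓝 0)

/-- The operator `T` is `S`-L-weakly compact (for a norm bounded set `S`): it maps uaw-null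
sequences in the solid hull of `S` to norm
null sequences. -/
def IsLwcOperator {Y : Type v} [NormedAddCommGroup Y] [NormedSpace ℝ Y]
    (S : Set E) (T : E →L[ℝ] Y) : Prop :=
  ∀ x : ℕ → E, (∀ n, x n ∈ LatticeOrderedAddCommGroup.solidClosure S) →
    UAWTendsto x 0 → Tendsto (fun n => T (x n)) atTop (𝓝 0)

/-- The net `x` has a subnet that is uaw-convergent to `a`. A subnet of `x : ι → E` is `x ∘ φ` for
a map `φ : κ → ι` from a directed set `κ` that eventually exceeds every index. -/
def HasUAWConvergentSubnet {ι : Type u} [Preorder ι] (x : ι → E) (a : E) : Prop :=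
  ∃ (κ : Type u) (_ : Preorder κ) (_ : IsDirectedOrder κ) (_ : Nonempty κ) (φ : κ → ι),
    Tendsto φ atTop atTop ∧ UAWTendsto (x ∘ φ) a

/-- The norm bounded set `A` is uaw-compact: every net in `A` has a subnet that is uaw-convergent
to an element of `A`. -/
def IsUAWCompact (A : Set E) : Prop :=
  Bornology.IsBounded A ∧
    ∀ (ι : Type u) [Preorder ι] [IsDirectedOrder ι] [Nonempty ι] (x : ι → E),
      (∀ i, x i ∈ A) → ∃ a ∈ A, HasUAWConvergentSubnet x a

/-- The norm bounded set `A` is relatively uaw-compact: every net in `A` has a subnet that is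
uaw-convergent to an element of the whole space. -/
def IsRelativelyUAWCompact (A : Set E) : Prop :=
  Bornology.IsBounded A ∧
    ∀ (ι : Type u) [Preorder ι] [IsDirectedOrder ι] [Nonempty ι] (x : ι → E),
      (∀ i, x i ∈ A) → ∃ a : E, HasUAWConvergentSubnet x a

end UAWDefinitions

/-! Everything passes through one sequential property, `OrderBoundedDisjointNull`. Order continuity
implies it, since partial sums of a disjoint sequence in `[0, v]` increase below `v`. Conversely it
forces order bounded increasing sequences to be Cauchy (`OrderBoundedDisjointNull.cauchySeq`): large
increments could be trimmed to a disjoint sequence that is not null. Completeness then gives order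
continuity.

The analytic core is `OrderBoundedDisjointNull.exists_norm_le_functional_add`: up to `ε`, a single
positive functional dominates the norm on `[0, v]`. This is condition 4 with `w = v`, and it turns
uaw-convergence inside order intervals into norm convergence. The way back rests on
`uawTendsto_zero_of_disjoint`: disjoint sequences are uaw-null, so 3, 7 and 8 each make the order
bounded ones norm null. -/

/-- Every disjoint sequence in an order interval `[0, v]` is norm null. -/
def OrderBoundedDisjointNull (E : Type u) [NormedAddCommGroup E] [Lattice E] : Prop :=
  ∀ v : E, ∀ x : ℕ → E, (∀ n, 0 ≤ x n) → (∀ n, x n ≤ v) → (∀ m n, m < n → x m ⊓ x n = 0) →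
    Tendsto x atTop (𝓝 0)

/-! ### Disjointness in lattice ordered groups and vector lattices -/

section LatticeGroup

theorem inf_eq_zero_of_le {G : Type u} [Lattice G] [Zero G] {a b c d : G}
    (ha : 0 ≤ a) (hb : 0 ≤ b) (hac : a ≤ c) (hbd : b ≤ d) (h : c ⊓ d = 0) : a ⊓ b = 0 :=
  le_antisymm (h ▸ inf_le_inf hac hbd) (le_inf ha hb)

variable {G : Type u} [AddCommGroup G] [Lattice G] [IsOrderedAddMonoid G]

theorem add_le_of_inf_eq_zero {a b w : G} (h : a ⊓ b = 0) (ha : a ≤ w) (hb : b ≤ w) :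
    a + b ≤ w := by
  rw [← inf_add_sup a b, h, zero_add]
  exact sup_le ha hb

theorem inf_add_eq_zero_of_inf_eq_zero {a b c : G} (ha : 0 ≤ a) (hb : 0 ≤ b) (hc : 0 ≤ c)
    (hab : a ⊓ b = 0) (hac : a ⊓ c = 0) : a ⊓ (b + c) = 0 := by
  refine le_antisymm ?_ (le_inf ha (add_nonneg hb hc))
  rw [← hac]
  refine le_inf inf_le_left ?_
  have h : a ⊓ (b + c) - c ≤ a ⊓ b :=
    le_inf ((sub_le_self _ hc).trans inf_le_left) (sub_le_iff_le_add.2 inf_le_right)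
  rw [hab] at h
  exact sub_nonpos.1 h

theorem inf_sum_eq_zero {α : Type*} {y : α → G} (s : Finset α) {a : G} (ha : 0 ≤ a)
    (hy : ∀ n, 0 ≤ y n) (h : ∀ n ∈ s, a ⊓ y n = 0) : a ⊓ ∑ n ∈ s, y n = 0 := by
  classical
  induction s using Finset.induction_on with
  | empty => simpa using ha
  | insert b s hb ih =>
    rw [Finset.sum_insert hb]
    exact inf_add_eq_zero_of_inf_eq_zero ha (hy b) (Finset.sum_nonneg fun n _ => hy n)
      (h b (Finset.mem_insert_self b s)) (ih fun n hn => h n (Finset.mem_insert_of_mem hn))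

theorem sum_le_of_pairwise_inf_eq_zero {α : Type*} {y : α → G} {w : G} (hw : 0 ≤ w)
    (hy : ∀ n, 0 ≤ y n) (hyw : ∀ n, y n ≤ w) (h : ∀ m n, m ≠ n → y m ⊓ y n = 0) (s : Finset α) :
    ∑ n ∈ s, y n ≤ w := by
  classical
  induction s using Finset.induction_on with
  | empty => simpa using hw
  | insert b s hb ih =>
    rw [Finset.sum_insert hb]
    refine add_le_of_inf_eq_zero (inf_sum_eq_zero s (hy b) hy fun n hn => h b n ?_) (hyw b) ih
    rintro rfl
    exact hb hn

theorem eq_inf_add_posPart_sub (a b : G) : a = a ⊓ b + (a - b)⁺ := by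
  rw [posPart_def, ← sub_self b, ← sup_sub, ← add_sub_assoc, inf_add_sup, add_sub_cancel_right]

theorem abs_sum_le_sum_abs_of_lattice {α : Type*} (s : Finset α) (f : α → G) :
    |∑ n ∈ s, f n| ≤ ∑ n ∈ s, |f n| :=
  Finset.le_sum_of_subadditive _ abs_zero.le abs_add_le s f

theorem disjoint_abs_of_disjoint {x : ℕ → G} (h0 : ∀ n, 0 ≤ x n)
    (h : ∀ m n, m < n → x m ⊓ x n = 0) (m n : ℕ) (hmn : m ≠ n) : |x m| ⊓ |x n| = 0 := by
  rw [abs_of_nonneg (h0 m), abs_of_nonneg (h0 n)]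
  exact hmn.lt_or_gt.elim (h m n) fun hnm => inf_comm (x m) (x n) ▸ h n m hnm

theorem abs_le_iff_mem_Icc {x v : G} : |x| ≤ v ↔ x ∈ Set.Icc (-v) v :=
  ⟨fun h => ⟨neg_le.1 ((neg_le_abs x).trans h), (le_abs_self x).trans h⟩,
    fun h => sup_le h.2 (neg_le.1 h.1)⟩

variable [Module ℝ G] [IsOrderedModule ℝ G]

theorem inf_smul_eq_zero {a b : G} {c : ℝ} (hc : 1 ≤ c) (hb : 0 ≤ b) (ha : 0 ≤ a)
    (h : a ⊓ b = 0) : a ⊓ c • b = 0 := by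
  have hc0 : 0 < c := by linarith
  refine le_antisymm ?_ (le_inf ha (smul_nonneg hc0.le hb))
  have ht0 : 0 ≤ a ⊓ c • b := le_inf ha (smul_nonneg hc0.le hb)
  have h1 : c⁻¹ • (a ⊓ c • b) ≤ a ⊓ b := by
    refine le_inf ?_ ?_
    · calc c⁻¹ • (a ⊓ c • b) ≤ (1 : ℝ) • (a ⊓ c • b) :=
            smul_le_smul_of_nonneg_right (inv_le_one_of_one_le₀ hc) ht0
        _ ≤ a := by rw [one_smul]; exact inf_le_left
    · calc c⁻¹ • (a ⊓ c • b) ≤ c⁻¹ • c • b :=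
            smul_le_smul_of_nonneg_left inf_le_right (inv_nonneg.2 hc0.le)
        _ = b := inv_smul_smul₀ hc0.ne' b
  rw [h] at h1
  have h2 := smul_le_smul_of_nonneg_left h1 hc0.le
  rwa [smul_inv_smul₀ hc0.ne', smul_zero] at h2

/-- Since `z - c • y = -c • (y - c⁻¹ • z)`, the two terms are controlled by the positive and
negative parts of one vector. This is the source of disjointness in the trimming argument. -/
theorem posPart_sub_inf_posPart_sub_smul {y z : G} {c : ℝ} (hc : 1 ≤ c) :
    (y - c⁻¹ • z)⁺ ⊓ (z - c • y)⁺ = 0 := by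
  have hc0 : 0 < c := by linarith
  have h := inf_smul_eq_zero hc (negPart_nonneg _) (posPart_nonneg _)
    (posPart_inf_negPart_eq_zero (y - c⁻¹ • z))
  refine inf_eq_zero_of_le (posPart_nonneg _) (posPart_nonneg _) le_rfl ?_ h
  refine sup_le ?_ (smul_nonneg hc0.le (negPart_nonneg _))
  calc z - c • y = c • (-(y - c⁻¹ • z)) := by
        rw [neg_sub, smul_sub, smul_inv_smul₀ hc0.ne']
    _ ≤ _ := smul_le_smul_of_nonneg_left (neg_le_negPart _) hc0.le

end LatticeGroup

/-! ### Trimming increments to a disjoint sequence -/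

section NormedLattice

variable {E : Type u} [NormedAddCommGroup E] [Lattice E] [IsOrderedAddMonoid E]
  [NormedSpace ℝ E] [IsOrderedModule ℝ E]

/-- If order bounded disjoint sequences are null, then late increments of an order bounded
increasing sequence are almost dominated by a multiple of an earlier increment. -/
theorem OrderBoundedDisjointNull.exists_norm_posPart_le (H : OrderBoundedDisjointNull E)
    {x : ℕ → E} {v : E} (hx : Monotone x) (h0 : ∀ n, 0 ≤ x n) (hv : ∀ n, x n ≤ v)
    {c : ℝ} (hc : 1 ≤ c) {ε : ℝ} (hε : 0 < ε) (p : ℕ) :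
    ∃ n, p ≤ n ∧ ∀ i j, n ≤ i → i ≤ j →
      ‖(x j - x i - c • (x n - x p) - c⁻¹ • v)⁺‖ ≤ ε := by
  by_contra! hcon
  have hc0 : 0 < c := by linarith
  choose! a b ha hab hbig using hcon
  set k : ℕ → ℕ := fun r => Nat.rec p (fun _ n => b n) r with hk
  have k_succ : ∀ r, k (r + 1) = b (k r) := fun r => rfl
  have hpk : ∀ r, p ≤ k r := by
    intro r
    induction r with
    | zero => exact le_rfl
    | succ r ih => rw [k_succ]; exact ih.trans ((ha _ ih).trans (hab _ ih))
  have hkmono : Monotone k := monotone_nat_of_le_succ fun r => by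
    rw [k_succ]; exact (ha _ (hpk r)).trans (hab _ (hpk r))
  have hv0 : 0 ≤ c⁻¹ • v := smul_nonneg (inv_nonneg.2 hc0.le) ((h0 0).trans (hv 0))
  set z : ℕ → E := fun r => x (b (k r)) - x (a (k r)) with hz
  have hz0 : ∀ r, 0 ≤ z r := fun r => sub_nonneg.2 (hx (hab _ (hpk r)))
  have hzv : ∀ r, z r ≤ v := fun r => (sub_le_self _ (h0 _)).trans (hv _)
  -- The trimmed increments: pairwise disjoint in `[0, v]`, yet all of norm greater than `ε`.
  set y : ℕ → E := fun r => (z r - c • (x (k r) - x p) - c⁻¹ • v)⁺ with hy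
  have hkp : ∀ r, 0 ≤ c • (x (k r) - x p) := fun r =>
    smul_nonneg hc0.le (sub_nonneg.2 (hx (hpk r)))
  have hyv : ∀ r, y r ≤ v := fun r =>
    sup_le ((sub_le_self _ hv0).trans ((sub_le_self _ (hkp r)).trans (hzv r)))
      ((h0 0).trans (hv 0))
  have hdisj : ∀ r s, r < s → y r ⊓ y s = 0 := by
    intro r s hrs
    -- As `z s ≤ v` and `z r ≤ x (k s) - x p` for `r < s`, one has `y r ≤ (z r - c⁻¹ • z s)⁺` and `y
    -- s ≤ (z s - c • z r)⁺`.
    refine inf_eq_zero_of_le (posPart_nonneg _) (posPart_nonneg _) (posPart_mono ?_)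
      (posPart_mono ?_) (posPart_sub_inf_posPart_sub_smul (y := z r) (z := z s) hc)
    · exact sub_le_sub (sub_le_self _ (hkp r))
        (smul_le_smul_of_nonneg_left (hzv s) (inv_nonneg.2 hc0.le))
    · refine (sub_le_self _ hv0).trans (sub_le_sub_left
        (smul_le_smul_of_nonneg_left ?_ hc0.le) _)
      refine sub_le_sub (hx ?_) (hx ((hpk r).trans (ha _ (hpk r))))
      rw [← k_succ]
      exact hkmono hrs
  have hlim := (H v y (fun _ => posPart_nonneg _) hyv hdisj).norm
  rw [norm_zero] at hlim
  obtain ⟨r, hr⟩ := (hlim.eventually (gt_mem_nhds hε)).exists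
  exact absurd hr (not_lt.2 (hbig _ (hpk r)).le)

end NormedLattice

/-! ### Order bounded increasing sequences are Cauchy -/

section SolidNorm

variable {E : Type u} [NormedAddCommGroup E] [Lattice E] [IsOrderedAddMonoid E] [HasSolidNorm E]

theorem norm_le_norm_of_nonneg_of_le {a b : E} (ha : 0 ≤ a) (hab : a ≤ b) : ‖a‖ ≤ ‖b‖ := by
  apply norm_le_norm_of_abs_le_abs
  rwa [abs_of_nonneg ha, abs_of_nonneg (ha.trans hab)]

theorem norm_posPart_le_norm (a : E) : ‖a⁺‖ ≤ ‖a‖ := by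
  apply norm_le_norm_of_abs_le_abs
  rw [abs_of_nonneg (posPart_nonneg a)]
  exact sup_le (le_abs_self a) (abs_nonneg a)

variable [NormedSpace ℝ E] [IsOrderedModule ℝ E]

/-- If order bounded disjoint sequences are null, then order bounded increasing sequences are
norm Cauchy. -/
theorem OrderBoundedDisjointNull.cauchySeq (H : OrderBoundedDisjointNull E)
    {x : ℕ → E} {v : E} (hx : Monotone x) (h0 : ∀ n, 0 ≤ x n) (hv : ∀ n, x n ≤ v) :
    CauchySeq x := by
  rw [Metric.cauchySeq_iff']
  intro δ hδ
  -- One `ε` each for the telescoped sum, the term `c⁻¹ • v` and the average of the remainders `e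
  -- r`. First `c` makes `c⁻¹ • v` small, then `N` absorbs `c * ‖v‖`.
  obtain ⟨ε, hε, hεδ⟩ : ∃ ε : ℝ, 0 < ε ∧ ε + ε + ε < δ := ⟨δ / 4, by linarith, by linarith⟩
  obtain ⟨c, hc, hcv⟩ : ∃ c : ℝ, 1 ≤ c ∧ ‖v‖ ≤ ε * c := by
    refine ⟨max 1 (‖v‖ / ε), le_max_left _ _, ?_⟩
    calc ‖v‖ = ε * (‖v‖ / ε) := by field_simp
      _ ≤ _ := mul_le_mul_of_nonneg_left (le_max_right _ _) hε.le
  have hc0 : 0 < c := by linarith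
  obtain ⟨N, hN, hNv⟩ : ∃ N : ℕ, 0 < N ∧ c * ‖v‖ ≤ N * ε := by
    obtain ⟨N, hN⟩ := exists_nat_gt (c * ‖v‖ / ε)
    refine ⟨N, ?_, ((div_lt_iff₀ hε).1 hN).le⟩
    exact_mod_cast lt_of_le_of_lt (by positivity : 0 ≤ c * ‖v‖ / ε) hN
  choose q hpq hq using H.exists_norm_posPart_le hx h0 hv hc hε
  set k : ℕ → ℕ := fun r => Nat.rec 0 (fun _ n => q n) r with hk
  have k_succ : ∀ r, k (r + 1) = q (k r) := fun r => rfl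
  have hkmono : Monotone k := monotone_nat_of_le_succ fun r => by rw [k_succ]; exact hpq _
  refine ⟨k N, fun j hj => ?_⟩
  rw [dist_eq_norm]
  set d := x j - x (k N) with hd
  have hd0 : 0 ≤ d := sub_nonneg.2 (hx hj)
  set e : ℕ → E := fun r => (d - c • (x (k (r + 1)) - x (k r)) - c⁻¹ • v)⁺ with he
  have hen : ∀ r < N, ‖e r‖ ≤ ε := fun r hr => hq (k r) (k N) j (hkmono hr) hj
  have hde : ∀ r, d ≤ c • (x (k (r + 1)) - x (k r)) + c⁻¹ • v + e r := by
    intro r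
    have := le_posPart (d - c • (x (k (r + 1)) - x (k r)) - c⁻¹ • v)
    rw [sub_sub] at this
    rw [sub_le_iff_le_add'] at this
    simpa [he, sub_sub] using this
  -- Averaging `N` estimates of the same `d` helps because the increments telescope to a vector of
  -- norm at most `‖v‖`, whatever `N` is.
  have hsum : N • d ≤ c • (x (k N) - x (k 0)) + N • (c⁻¹ • v) + ∑ r ∈ Finset.range N, e r := by
    calc N • d = ∑ r ∈ Finset.range N, d := by simp
      _ ≤ ∑ r ∈ Finset.range N, (c • (x (k (r + 1)) - x (k r)) + c⁻¹ • v + e r) :=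
          Finset.sum_le_sum fun r _ => hde r
      _ = _ := by
          rw [Finset.sum_add_distrib, Finset.sum_add_distrib, ← Finset.smul_sum,
            Finset.sum_range_sub (fun r => x (k r))]
          simp
  have h1 : ‖x (k N) - x (k 0)‖ ≤ ‖v‖ :=
    norm_le_norm_of_nonneg_of_le (sub_nonneg.2 (hx (hkmono (Nat.zero_le N))))
      ((sub_le_self _ (h0 _)).trans (hv _))
  have h2 : ‖∑ r ∈ Finset.range N, e r‖ ≤ N * ε := by
    calc _ ≤ ∑ r ∈ Finset.range N, ε :=
          norm_sum_le_of_le _ fun r hr => hen r (Finset.mem_range.1 hr)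
      _ = _ := by simp
  have h3 : ‖c⁻¹ • v‖ ≤ ε := by
    rw [norm_smul, norm_inv, Real.norm_of_nonneg hc0.le, inv_mul_le_iff₀ hc0, mul_comm]
    exact hcv
  have h4 : (N : ℝ) * ‖d‖ ≤ N * (ε + ε + ε) := by
    calc (N : ℝ) * ‖d‖ = ‖N • d‖ := by
          rw [← Nat.cast_smul_eq_nsmul ℝ, norm_smul]; simp
      _ ≤ _ := norm_le_norm_of_nonneg_of_le (nsmul_nonneg hd0 N) hsum
      _ ≤ ‖c • (x (k N) - x (k 0))‖ + ‖N • (c⁻¹ • v)‖ + ‖∑ r ∈ Finset.range N, e r‖ :=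
          norm_add₃_le
      _ ≤ c * ‖v‖ + N * ε + N * ε := by
          refine add_le_add_three ?_ ?_ h2
          · rw [norm_smul, Real.norm_of_nonneg hc0.le]
            exact mul_le_mul_of_nonneg_left h1 hc0.le
          · rw [← Nat.cast_smul_eq_nsmul ℝ, norm_smul]
            simpa using mul_le_mul_of_nonneg_left h3 (Nat.cast_nonneg N)
      _ ≤ _ := by linarith
  have := le_of_mul_le_mul_left h4 (by exact_mod_cast hN)
  linarith

end SolidNorm

/-! ### Positive functionals dominating the norm up to `ε` -/

section PositiveFunctionals

theorem norm_posPart_add_le {E : Type u} [NormedAddCommGroup E] [Lattice E]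
    [IsOrderedAddMonoid E] [HasSolidNorm E] (x y : E) : ‖(x + y)⁺‖ ≤ ‖x⁺‖ + ‖y⁺‖ := by
  refine (norm_le_norm_of_nonneg_of_le (posPart_nonneg _) ?_).trans (norm_add_le _ _)
  exact sup_le (add_le_add (le_posPart x) (le_posPart y))
    (add_nonneg (posPart_nonneg x) (posPart_nonneg y))

theorem positive_functional_mono {E : Type u} [NormedAddCommGroup E] [NormedSpace ℝ E]
    [Lattice E] [IsOrderedAddMonoid E] {f : StrongDual ℝ E}
    (hf : ∀ y, 0 ≤ y → 0 ≤ f y) {x y : E} (h : x ≤ y) : f x ≤ f y := by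
  have := hf _ (sub_nonneg.2 h)
  rw [map_sub] at this
  exact sub_nonneg.1 this

variable {E : Type u} [NormedAddCommGroup E] [NormedSpace ℝ E] [Lattice E]
  [IsOrderedAddMonoid E] [IsOrderedModule ℝ E] [HasSolidNorm E]

theorem norm_posPart_smul {c : ℝ} (hc : 0 < c) (x : E) : ‖(c • x)⁺‖ = c * ‖x⁺‖ := by
  have key : ∀ {c : ℝ}, 0 < c → ∀ x : E, ‖(c • x)⁺‖ ≤ c * ‖x⁺‖ := by
    intro c hc x
    rw [← Real.norm_of_nonneg hc.le, ← norm_smul, Real.norm_of_nonneg hc.le]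
    exact norm_le_norm_of_nonneg_of_le (posPart_nonneg _)
      (sup_le (smul_le_smul_of_nonneg_left (le_posPart x) hc.le)
        (smul_nonneg hc.le (posPart_nonneg x)))
  refine le_antisymm (key hc x) ?_
  have h := key (inv_pos.2 hc) (c • x)
  rw [inv_smul_smul₀ hc.ne'] at h
  calc c * ‖x⁺‖ ≤ c * (c⁻¹ * ‖(c • x)⁺‖) := mul_le_mul_of_nonneg_left h hc.le
    _ = _ := mul_inv_cancel_left₀ hc.ne' _

/-- Every positive vector is normed by a positive functional of norm at most one. -/
theorem exists_positive_functional_eq_norm {x : E} (hx : 0 ≤ x) :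
    ∃ f : StrongDual ℝ E, (∀ y, 0 ≤ y → 0 ≤ f y) ∧ (∀ y, f y ≤ ‖y‖) ∧ f x = ‖x‖ := by
  by_cases hx0 : x = 0
  · exact ⟨0, by simp, by simp, by simp [hx0]⟩
  -- Hahn–Banach with `‖y⁺‖` in place of `‖y‖`: for `y ≥ 0` the bound at `-y` is `0`, which makes
  -- the extension positive.
  obtain ⟨g, hg, hgN⟩ := exists_extension_of_le_sublinear
    (LinearPMap.mkSpanSingleton x ‖x‖ hx0) (fun y => ‖y⁺‖) (fun c hc y => norm_posPart_smul hc y)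
    norm_posPart_add_le (by
      rintro ⟨y, hy⟩
      obtain ⟨c, rfl⟩ := Submodule.mem_span_singleton.1 hy
      rw [LinearPMap.mkSpanSingleton'_apply]
      rcases lt_or_ge 0 c with hc | hc
      · simp only [norm_posPart_smul hc, posPart_of_nonneg hx, smul_eq_mul, RingHom.id_apply, le_refl]
      · exact (mul_nonpos_of_nonpos_of_nonneg hc (norm_nonneg x)).trans (norm_nonneg _))
  have hle : ∀ y, g y ≤ ‖y‖ := fun y => (hgN y).trans (norm_posPart_le_norm y)
  refine ⟨g.mkContinuous 1 fun y => ?_, fun y hy => ?_, hle, ?_⟩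
  · rw [one_mul, Real.norm_eq_abs]
    refine abs_le'.2 ⟨hle y, ?_⟩
    rw [← map_neg, ← norm_neg]
    exact hle (-y)
  · have h := hgN (-y)
    simp only [map_neg, posPart_of_nonpos (neg_nonpos.2 hy), norm_zero] at h
    exact neg_nonpos.1 h
  · have h := hg ⟨x, Submodule.mem_span_singleton_self x⟩
    have h1 := LinearPMap.mkSpanSingleton_apply ℝ ℝ (σ := RingHom.id ℝ) hx0 ‖x‖
    exact h.trans h1

variable [CompleteSpace E]

/-- The tails of an order bounded positive sequence have suprema, which decrease to a norm
limit, when order bounded disjoint sequences are null. -/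
theorem OrderBoundedDisjointNull.exists_tail_sup (H : OrderBoundedDisjointNull E)
    {x : ℕ → E} {v : E} (h0 : ∀ n, 0 ≤ x n) (hv : ∀ n, x n ≤ v) :
    ∃ (s : ℕ → E) (a : E), (∀ n, x n ≤ s n) ∧ (∀ n, a ≤ s n) ∧ 0 ≤ a ∧ Tendsto s atTop (𝓝 a) ∧
      ∀ n, Tendsto (fun m => partialSups (fun k => x (n + k)) m) atTop (𝓝 (s n)) := by
  have hp0 : ∀ n m, 0 ≤ partialSups (fun k => x (n + k)) m := fun n m =>
    (h0 _).trans (le_partialSups_of_le (fun k => x (n + k)) (Nat.zero_le m))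
  have hc : ∀ n, ∃ s, Tendsto (fun m => partialSups (fun k => x (n + k)) m) atTop (𝓝 s) :=
    fun n => cauchySeq_tendsto_of_complete (H.cauchySeq (partialSups _).monotone (hp0 n)
      fun m => partialSups_le _ _ _ fun _ _ => hv _)
  choose s hs using hc
  have hxs : ∀ n k, x (n + k) ≤ s n := fun n k =>
    ge_of_tendsto (hs n) ((eventually_ge_atTop k).mono fun m hm =>
      le_partialSups_of_le (fun k => x (n + k)) hm)
  have hs0 : ∀ n, 0 ≤ s n := fun n => ge_of_tendsto' (hs n) (hp0 n)
  have hanti : Antitone s := antitone_nat_of_succ_le fun n => by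
    refine le_of_tendsto' (hs (n + 1)) fun m => partialSups_le _ _ _ fun k _ => ?_
    rw [add_assoc]
    exact hxs n (1 + k)
  -- The Cauchy criterion is for increasing sequences, so the decreasing `s` is reflected in `s 0`.
  have hcs : CauchySeq fun n => s 0 - s n :=
    H.cauchySeq (v := s 0) (fun m n h => sub_le_sub_left (hanti h) _)
      (fun n => sub_nonneg.2 (hanti (Nat.zero_le n))) (fun n => sub_le_self _ (hs0 n))
  obtain ⟨b, hb⟩ := cauchySeq_tendsto_of_complete hcs
  have ha : Tendsto s atTop (𝓝 (s 0 - b)) := by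
    simpa using hb.const_sub (s 0)
  exact ⟨s, s 0 - b, fun n => hxs n 0, fun n => hanti.le_of_tendsto ha n,
    ge_of_tendsto' ha hs0, ha, hs⟩

/-- When order bounded disjoint sequences are null, the norm on an order interval is dominated by
a positive functional up to `ε`. -/
theorem OrderBoundedDisjointNull.exists_norm_le_functional_add (H : OrderBoundedDisjointNull E)
    {ε : ℝ} (hε : 0 < ε) (v : E) :
    ∃ g : StrongDual ℝ E, (∀ x, 0 ≤ x → 0 ≤ g x) ∧ ∀ x, 0 ≤ x → x ≤ v → ‖x‖ ≤ g x + ε := by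
  by_contra! hcon
  choose! X hX0 hXv hX using hcon
  choose! F hF0 hFn hFx using fun (x : E) (hx : 0 ≤ x) => exists_positive_functional_eq_norm hx
  -- `G n` is the sum of the functionals norming `x 0, …, x (n - 1)`, and `x n` violates the claim
  -- for `2 ^ n • G n`. So earlier functionals are summably small on later vectors.
  set G : ℕ → StrongDual ℝ E := fun n =>
    Nat.rec 0 (fun n g => g + F (X ((2 : ℝ) ^ n • g))) n with hG
  set x : ℕ → E := fun n => X ((2 : ℝ) ^ n • G n) with hxdef
  have G_succ : ∀ n, G (n + 1) = G n + F (x n) := fun n => rfl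
  have hsm : ∀ n, (∀ y, 0 ≤ y → 0 ≤ G n y) → ∀ y, 0 ≤ y → 0 ≤ ((2 : ℝ) ^ n • G n) y :=
    fun n h y hy => mul_nonneg (by positivity) (h y hy)
  have hGpos : ∀ n, ∀ y, 0 ≤ y → 0 ≤ G n y := by
    intro n
    induction n with
    | zero => intro y _; exact le_rfl
    | succ n ih =>
      intro y hy
      rw [G_succ]
      exact add_nonneg (ih y hy) (hF0 _ (hX0 _ (hsm n ih)) y hy)
  have hx0 : ∀ n, 0 ≤ x n := fun n => hX0 _ (hsm n (hGpos n))
  have hxv : ∀ n, x n ≤ v := fun n => hXv _ (hsm n (hGpos n))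
  have hxbig : ∀ n, (2 : ℝ) ^ n * G n (x n) + ε < ‖x n‖ := fun n => hX _ (hsm n (hGpos n))
  have hGF : ∀ i n, i < n → ∀ y, 0 ≤ y → F (x i) y ≤ G n y := by
    intro i n hin y hy
    induction n, hin using Nat.le_induction with
    | base => rw [G_succ]; exact le_add_of_nonneg_left (hGpos i y hy)
    | succ n _ ih => rw [G_succ]; exact ih.trans (le_add_of_nonneg_right (hF0 _ (hx0 n) y hy))
  have hsmall : ∀ i n, i < n → F (x i) (x n) ≤ ‖v‖ * (1 / 2) ^ n := by
    intro i n hin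
    have h1 : (2 : ℝ) ^ n * F (x i) (x n) ≤ ‖v‖ := by
      have := mul_le_mul_of_nonneg_left (hGF i n hin (x n) (hx0 n))
        (by positivity : (0 : ℝ) ≤ 2 ^ n)
      linarith [hxbig n, norm_le_norm_of_nonneg_of_le (hx0 n) (hxv n)]
    rw [one_div, inv_pow, ← div_eq_mul_inv, le_div_iff₀ (by positivity), mul_comm]
    exact h1
  obtain ⟨s, a, hxs, has, ha0, hsa, hs⟩ := H.exists_tail_sup hx0 hxv
  have hps : ∀ i n, i < n → F (x i) (s n) ≤ ‖v‖ * (1 / 2) ^ n * 2 := by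
    intro i n hin
    -- A supremum of positive vectors is at most their sum; the factor `2 - (1 / 2) ^ m` is the
    -- partial geometric sum.
    have hm : ∀ m, F (x i) (partialSups (fun k => x (n + k)) m) ≤
        ‖v‖ * (1 / 2) ^ n * (2 - (1 / 2) ^ m) := by
      intro m
      induction m with
      | zero =>
        have := hsmall i n hin
        simp only [partialSups_zero, add_zero, pow_zero]
        linarith
      | succ m ih =>
        have h1 : partialSups (fun k => x (n + k)) (m + 1) ≤
            partialSups (fun k => x (n + k)) m + x (n + (m + 1)) := by
          rw [partialSups_add_one]
          exact sup_le (le_add_of_nonneg_right (hx0 _)) (le_add_of_nonneg_left ((hx0 _).trans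
            (le_partialSups_of_le (fun k => x (n + k)) (Nat.zero_le m))))
        have h2 := positive_functional_mono (hF0 _ (hx0 i)) h1
        have h3 := hsmall i (n + (m + 1)) (by omega)
        rw [map_add (F (x i))] at h2
        have h4 : ‖v‖ * (1 / 2) ^ n * (2 - (1 / 2) ^ m) + ‖v‖ * (1 / 2) ^ (n + (m + 1)) =
          ‖v‖ * (1 / 2) ^ n * (2 - (1 / 2) ^ (m + 1)) := by ring
        linarith
    refine le_of_tendsto' (((F (x i)).continuous.tendsto _).comp (hs n)) fun m =>
      (hm m).trans ?_
    have : (0 : ℝ) ≤ (1 / 2) ^ m := by positivity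
    exact mul_le_mul_of_nonneg_left (by linarith) (by positivity)
  have hFa : ∀ i, F (x i) a ≤ 0 := by
    intro i
    have hlim : Tendsto (fun n : ℕ => ‖v‖ * (1 / 2 : ℝ) ^ n * 2) atTop (𝓝 0) := by
      simpa using ((tendsto_pow_atTop_nhds_zero_of_lt_one (by norm_num : (0 : ℝ) ≤ 1 / 2)
        (by norm_num)).const_mul ‖v‖).mul_const 2
    exact ge_of_tendsto hlim ((eventually_gt_atTop i).mono fun n hn =>
      (positive_functional_mono (hF0 _ (hx0 i)) (has n)).trans (hps i n hn))
  -- Each `F (x n)` exceeds `ε` at `x n ≤ s n` but is nonpositive at `a`, which keeps `s n` away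
  -- from its limit.
  have hlow : ∀ n, ε ≤ ‖s n - a‖ := by
    intro n
    have h1 := positive_functional_mono (hF0 _ (hx0 n)) (hxs n)
    rw [hFx _ (hx0 n)] at h1
    have h2 := hFn _ (hx0 n) (s n - a)
    rw [map_sub] at h2
    have h3 : 0 ≤ (2 : ℝ) ^ n * G n (x n) := mul_nonneg (by positivity) (hGpos n _ (hx0 n))
    linarith [hxbig n, hFa n]
  have hz : Tendsto (fun n => ‖s n - a‖) atTop (𝓝 0) := by
    simpa using (hsa.sub_const a).norm
  exact absurd (ge_of_tendsto' hz hlow) (not_le.2 hε)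

end PositiveFunctionals

/-! ### Order continuity, disjoint sequences and compactness -/

section OrderContinuity

variable {E : Type u} [NormedAddCommGroup E] [Lattice E] [IsOrderedAddMonoid E] [HasSolidNorm E]

/-- The sequence need not have a supremum, so order continuity is applied to all differences `y - x
n` with `y` an upper bound. They decrease to `0` and dominate the late increments. -/
theorem IsOrderContinuousLattice.cauchySeq [NormedSpace ℝ E] [IsOrderedModule ℝ E]
    (H : IsOrderContinuousLattice E) {x : ℕ → E}
    {v : E} (hx : Monotone x) (hv : ∀ n, x n ≤ v) : CauchySeq x := by
  let U : Set E := upperBounds (Set.range x)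
  have hU : ∀ y : U, ∀ n, x n ≤ y := fun y n => y.2 (Set.mem_range_self n)
  have : IsDirectedOrder ((↥U)ᵒᵈ) := ⟨fun y z =>
    ⟨OrderDual.toDual ⟨(OrderDual.ofDual y).1 ⊓ (OrderDual.ofDual z).1, by
      rintro _ ⟨n, rfl⟩
      exact le_inf (hU _ n) (hU _ n)⟩,
      (inf_le_left : (OrderDual.ofDual y).1 ⊓ (OrderDual.ofDual z).1 ≤ _),
      (inf_le_right : (OrderDual.ofDual y).1 ⊓ (OrderDual.ofDual z).1 ≤ _)⟩⟩
  have : Nonempty ((↥U)ᵒᵈ) :=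
    ⟨OrderDual.toDual ⟨v, by rintro _ ⟨n, rfl⟩; exact hv n⟩⟩
  have : IsDirectedOrder ((↥U)ᵒᵈ × ℕ) := ⟨fun p q => by
    obtain ⟨y, hy₁, hy₂⟩ := exists_ge_ge p.1 q.1
    exact ⟨(y, max p.2 q.2), ⟨hy₁, le_max_left _ _⟩, ⟨hy₂, le_max_right _ _⟩⟩⟩
  have hlim := H ((↥U)ᵒᵈ × ℕ) (fun p => (OrderDual.ofDual p.1).1 - x p.2)
    (fun p q h => sub_le_sub h.1 (hx h.2)) ⟨?_, ?_⟩
  · rw [Metric.cauchySeq_iff']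
    intro ε hε
    obtain ⟨⟨y, N⟩, hyN⟩ := (hlim.norm.eventually
      (gt_mem_nhds (show ‖(0 : E)‖ < ε by simpa using hε))).exists
    refine ⟨N, fun n hn => lt_of_le_of_lt ?_ hyN⟩
    rw [dist_eq_norm]
    exact norm_le_norm_of_nonneg_of_le (sub_nonneg.2 (hx hn))
      (sub_le_sub_right (hU (OrderDual.ofDual y) n) _)
  · rintro _ ⟨p, rfl⟩
    exact sub_nonneg.2 (hU _ _)
  · intro z hz
    have hz' : ∀ y : E, y ∈ U → ∀ n, z ≤ y - x n := fun y hy n =>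
      hz ⟨(OrderDual.toDual ⟨y, hy⟩, n), rfl⟩
    -- Subtracting a lower bound `z` of the differences from an upper bound gives another upper
    -- bound. Iterating, `k • z` stays below `v - x 0`, and the Archimedean property yields `z ≤ 0`.
    have hk : ∀ k : ℕ, v - k • z ∈ U := by
      intro k
      induction k with
      | zero => rintro _ ⟨n, rfl⟩; simpa using hv n
      | succ k ih =>
        rintro _ ⟨n, rfl⟩
        rw [succ_nsmul, ← sub_sub]
        exact le_sub_comm.1 (hz' _ ih n)
    have hle : ∀ k : ℕ, z ≤ (1 / ((k : ℝ) + 1)) • (v - x 0) := by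
      intro k
      have hk1 : (0 : ℝ) < (k : ℝ) + 1 := by positivity
      have h1 : ((k : ℝ) + 1) • z ≤ v - x 0 := by
        have := le_sub_comm.1 (hk (k + 1) (Set.mem_range_self 0))
        rwa [← Nat.cast_smul_eq_nsmul ℝ, Nat.cast_add, Nat.cast_one] at this
      have h2 := smul_le_smul_of_nonneg_left h1 (one_div_pos.2 hk1).le
      rwa [smul_smul, one_div_mul_cancel hk1.ne', one_smul] at h2
    have h0 : Tendsto (fun k : ℕ => (1 / ((k : ℝ) + 1)) • (v - x 0)) atTop (𝓝 0) := by
      simpa using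
        (tendsto_one_div_add_atTop_nhds_zero_nat (𝕜 := ℝ)).smul_const (v - x 0)
    exact ge_of_tendsto' h0 hle

theorem IsOrderContinuousLattice.orderBoundedDisjointNull [NormedSpace ℝ E] [IsOrderedModule ℝ E]
    (H : IsOrderContinuousLattice E) : OrderBoundedDisjointNull E := by
  intro v x h0 hv hd
  have hd' : ∀ m n, m ≠ n → x m ⊓ x n = 0 := fun m n h =>
    h.lt_or_gt.elim (hd m n) fun h => inf_comm (x m) (x n) ▸ hd n m h
  have hc : CauchySeq fun n => ∑ k ∈ Finset.range n, x k :=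
    H.cauchySeq (v := v)
      (fun m n h => Finset.sum_le_sum_of_subset_of_nonneg (Finset.range_mono h)
        fun k _ _ => h0 k)
      (fun n => sum_le_of_pairwise_inf_eq_zero ((h0 0).trans (hv 0)) h0 hv hd' _)
  rw [Metric.tendsto_atTop]
  intro ε hε
  obtain ⟨N, hN⟩ := Metric.cauchySeq_iff.1 hc ε hε
  refine ⟨N, fun n hn => ?_⟩
  have := hN (n + 1) (hn.trans n.le_succ) n hn
  rwa [dist_eq_norm, Finset.sum_range_succ, add_sub_cancel_left, ← dist_zero_right] at this

theorem OrderBoundedDisjointNull.isOrderContinuousLattice [NormedSpace ℝ E] [IsOrderedModule ℝ E]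
    [CompleteSpace E] (H : OrderBoundedDisjointNull E) : IsOrderContinuousLattice E := by
  intro ι _ _ _ x hx hglb
  have h0 : ∀ i, 0 ≤ x i := fun i => hglb.1 (Set.mem_range_self i)
  have key : ∀ ε > 0, ∃ i, ∀ j, i ≤ j → ‖x i - x j‖ < ε := by
    intro ε hε
    by_contra! hcon
    choose J hJ hJn using hcon
    obtain ⟨i₀⟩ := ‹Nonempty ι›
    -- A net that is not Cauchy yields a decreasing sequence with all steps of norm at least `ε`.
    let k : ℕ → ι := fun r => Nat.rec i₀ (fun _ i => J i) r
    have hk : Monotone k := monotone_nat_of_le_succ fun r => hJ (k r)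
    have hc : CauchySeq fun n => x (k 0) - x (k n) :=
      H.cauchySeq (v := x (k 0)) (fun m n h => sub_le_sub_left (hx (hk h)) _)
        (fun n => sub_nonneg.2 (hx (hk (Nat.zero_le n)))) (fun n => sub_le_self _ (h0 _))
    obtain ⟨N, hN⟩ := Metric.cauchySeq_iff'.1 hc ε hε
    have h1 := hN (N + 1) N.le_succ
    rw [dist_eq_norm, sub_sub_sub_cancel_left] at h1
    exact absurd h1 (not_lt.2 (hJn (k N)))
  have hcauchy : Cauchy (map x atTop) := by
    rw [Metric.cauchy_iff]
    refine ⟨inferInstance, fun ε hε => ?_⟩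
    obtain ⟨i, hi⟩ := key (ε / 2) (half_pos hε)
    refine ⟨x '' Set.Ici i, image_mem_map (Ici_mem_atTop i), ?_⟩
    rintro _ ⟨j, hj, rfl⟩ _ ⟨l, hl, rfl⟩
    have h1 := dist_triangle_left (x j) (x l) (x i)
    have h2 := hi j hj
    have h3 := hi l hl
    rw [← dist_eq_norm] at h2 h3
    linarith
  obtain ⟨a, ha⟩ := CompleteSpace.complete hcauchy
  have ha' : Tendsto x atTop (𝓝 a) := ha
  rwa [(isGLB_of_tendsto_atTop hx ha').unique hglb] at ha'

/-- A subsequential limit `a` is disjoint from every `x n`, hence from itself, so `a = 0`. -/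
theorem tendsto_zero_of_disjoint_of_isCompact {K : Set E} (hK : IsCompact K) {x : ℕ → E}
    (hxK : ∀ n, x n ∈ K) (hd : ∀ m n, m < n → x m ⊓ x n = 0) : Tendsto x atTop (𝓝 0) := by
  refine tendsto_of_subseq_tendsto fun ns hns => ?_
  obtain ⟨a, -, ms, hms, ha⟩ := hK.tendsto_subseq fun n => hxK (ns n)
  refine ⟨ms, ?_⟩
  have hto : Tendsto (ns ∘ ms) atTop atTop := hns.comp hms.tendsto_atTop
  have h1 : ∀ n, x n ⊓ a = 0 := fun n => by
    refine tendsto_nhds_unique (tendsto_const_nhds.inf_nhds ha) ?_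
    refine tendsto_const_nhds.congr' ?_
    filter_upwards [hto.eventually (eventually_gt_atTop n)] with m hm
    exact (hd n _ hm).symm
  have h2 : a ⊓ a = 0 :=
    tendsto_nhds_unique (ha.inf_nhds tendsto_const_nhds)
      (tendsto_const_nhds.congr fun n => (h1 _).symm)
  rw [inf_idem] at h2
  rwa [h2] at ha

/-- If order bounded disjoint sequences are null, relatively compact sets are L-weakly compact. -/
theorem OrderBoundedDisjointNull.isLWeaklyCompact (H : OrderBoundedDisjointNull E) {S : Set E}
    (hS : IsCompact (closure S)) : IsLWeaklyCompact S := by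
  refine ⟨hS.isBounded.subset subset_closure, fun x hx hd => ?_⟩
  choose y hyS hxy using hx
  rw [Metric.tendsto_nhds]
  intro ε hε
  obtain ⟨t, ht, hSt⟩ := Metric.totallyBounded_iff.1
    (hS.totallyBounded.subset subset_closure) (ε / 2) (half_pos hε)
  -- Summing the moduli of a finite `ε / 2`-net reduces to the order bounded case: the part of `|x
  -- n|` above `v` has norm at most `ε / 2`.
  set v : E := ∑ z ∈ ht.toFinset, |z| with hv
  have hv0 : 0 ≤ v := Finset.sum_nonneg fun z _ => abs_nonneg z
  have hrest : ∀ n, ‖(|x n| - v)⁺‖ ≤ ε / 2 := by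
    intro n
    obtain ⟨z, hz, hyz⟩ := Set.mem_iUnion₂.1 (hSt (hyS n))
    rw [Metric.mem_ball, dist_eq_norm] at hyz
    refine le_trans ?_ hyz.le
    have hzv : |z| ≤ v :=
      Finset.single_le_sum (f := fun z : E => |z|) (fun z _ => abs_nonneg z) (ht.mem_toFinset.2 hz)
    rw [← norm_abs_eq_norm (y n - z)]
    refine norm_le_norm_of_nonneg_of_le (posPart_nonneg _) (sup_le ?_ (abs_nonneg _))
    calc |x n| - v ≤ |y n| - |z| := sub_le_sub (hxy n) hzv
      _ ≤ |y n - z| := by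
          rw [sub_le_iff_le_add]
          simpa using abs_add_le (y n - z) z
  have hmain : Tendsto (fun n => |x n| ⊓ v) atTop (𝓝 0) :=
    H v _ (fun n => le_inf (abs_nonneg _) hv0) (fun n => inf_le_right) fun m n hmn =>
      inf_eq_zero_of_le (le_inf (abs_nonneg _) hv0) (le_inf (abs_nonneg _) hv0) inf_le_left
        inf_le_left (hd m n hmn.ne)
  filter_upwards [Metric.tendsto_nhds.1 hmain (ε / 2) (half_pos hε)] with n hn
  rw [dist_zero_right] at hn ⊢
  calc ‖x n‖ = ‖|x n| ⊓ v + (|x n| - v)⁺‖ := by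
        rw [← eq_inf_add_posPart_sub, norm_abs_eq_norm]
    _ ≤ ‖|x n| ⊓ v‖ + ‖(|x n| - v)⁺‖ := norm_add_le _ _
    _ < ε := by linarith [hrest n]

end OrderContinuity

/-! ### Uaw-convergence and uaw-compactness -/

section UnboundedAbsoluteWeak

section NormedLattice

variable {E : Type u} [NormedAddCommGroup E] [NormedSpace ℝ E] [Lattice E]

theorem UAWTendsto.norm_tendsto_of_norm_le {ι : Type*} [Preorder ι] [IsDirectedOrder ι]
    [Nonempty ι] {x : ι → E} (hx : UAWTendsto x 0)
    (h : ∀ ε : ℝ, 0 < ε → ∃ g : StrongDual ℝ E, ∃ w : E, 0 ≤ w ∧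
      ∀ i, ‖x i‖ ≤ g (|x i| ⊓ w) + ε) : Tendsto x atTop (𝓝 0) := by
  rw [Metric.tendsto_nhds]
  intro ε hε
  obtain ⟨g, w, hw, hg⟩ := h (ε / 2) (half_pos hε)
  filter_upwards [(hx w hw g).eventually (gt_mem_nhds (half_pos hε))] with i hi
  rw [sub_zero] at hi
  rw [dist_zero_right]
  linarith [hg i]

theorem IsUAWCompact.isRelativelyUAWCompact {A : Set E} (h : IsUAWCompact A) :
    IsRelativelyUAWCompact A :=
  ⟨h.1, fun ι _ _ _ x hx => (h.2 ι x hx).imp fun _ ha => ha.2⟩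

variable [IsOrderedAddMonoid E]

theorem abs_sign_smul_le (t : ℝ) {y : E} (hy : 0 ≤ y) : |(SignType.sign t : ℝ) • y| ≤ y := by
  rcases lt_trichotomy t 0 with h | rfl | h
  · simp [sign_neg h, abs_of_nonneg hy]
  · simpa using hy
  · simp [sign_pos h, abs_of_nonneg hy]

/-- The set formed by `0` and the terms of a uaw-null sequence with bounded range is
uaw-compact. -/
theorem isUAWCompact_insert_zero_range {x : ℕ → E} (hx : UAWTendsto x 0)
    (hb : Bornology.IsBounded (insert 0 (Set.range x))) :
    IsUAWCompact (insert 0 (Set.range x)) := by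
  refine ⟨hb, fun ι _ _ _ y hy => ?_⟩
  -- If some value recurs, there is a constant subnet. Otherwise the net eventually leaves each
  -- finite set of terms, and is itself uaw-null.
  by_cases hfr : ∃ a ∈ insert 0 (Set.range x), ∃ᶠ i in atTop, y i = a
  · obtain ⟨a, ha, hfr⟩ := hfr
    rw [frequently_atTop] at hfr
    have : IsDirectedOrder {i // y i = a} := ⟨fun i j => by
      obtain ⟨k, hik, hjk⟩ := exists_ge_ge i.1 j.1
      obtain ⟨l, hkl, hl⟩ := hfr k
      exact ⟨⟨l, hl⟩, hik.trans hkl, hjk.trans hkl⟩⟩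
    have : Nonempty {i // y i = a} := by
      obtain ⟨i₀⟩ := ‹Nonempty ι›
      obtain ⟨l, -, hl⟩ := hfr i₀
      exact ⟨⟨l, hl⟩⟩
    refine ⟨a, ha, {i // y i = a}, inferInstance, inferInstance, inferInstance, Subtype.val,
      ?_, ?_⟩
    · refine tendsto_atTop.2 fun i => ?_
      obtain ⟨l, hil, hl⟩ := hfr i
      exact (eventually_ge_atTop (⟨l, hl⟩ : {i // y i = a})).mono fun j hj => hil.trans hj
    · intro w hw f
      refine tendsto_const_nhds.congr fun i => ?_
      simp [i.2, hw]
  · push Not at hfr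
    refine ⟨0, Set.mem_insert _ _, ι, inferInstance, inferInstance, inferInstance, id,
      tendsto_id, ?_⟩
    intro w hw f
    rw [Metric.tendsto_nhds]
    intro ε hε
    obtain ⟨N, hN⟩ := eventually_atTop.1 (Metric.tendsto_nhds.1 (hx w hw f) ε hε)
    have hne : ∀ᶠ i in atTop, ∀ n ∈ Finset.range N, y i ≠ x n :=
      (eventually_all_finset _).2 fun n _ =>
        hfr (x n) (Set.mem_insert_of_mem _ (Set.mem_range_self n))
    filter_upwards [hne] with i hi
    rcases hy i with h | ⟨n, hn⟩
    · simpa [h, hw] using hε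
    · have hn' : N ≤ n := by
        by_contra hlt
        exact hi n (Finset.mem_range.2 (not_le.1 hlt)) hn.symm
      simpa [hn] using hN n hn'

/-- The sequence `x` lies in `[a, b]`, and uaw-null nets in order intervals are norm null. Then the
limit of any uaw-convergent subnet of `x` is the norm limit of a subsequence. -/
theorem HasUAWConvergentSubnet.exists_tendsto_subseq
    (H : ∀ v : E, 0 ≤ v → ∀ (ι : Type u) [Preorder ι] [IsDirectedOrder ι] [Nonempty ι]
      (x : ι → E), (∀ i, x i ∈ Set.Icc (-v) v) → UAWTendsto x 0 → Tendsto x atTop (𝓝 0))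
    {x : ℕ → E} {a b l : E} (hx : ∀ n, x n ∈ Set.Icc a b)
    (h : HasUAWConvergentSubnet (fun n : ULift.{u} ℕ => x n.down) l) :
    ∃ ψ : ℕ → ℕ, StrictMono ψ ∧ Tendsto (x ∘ ψ) atTop (𝓝 l) := by
  obtain ⟨κ, _, _, _, φ, hφ, hu⟩ := h
  have hdown : Tendsto (ULift.down : ULift.{u} ℕ → ℕ) atTop atTop :=
    tendsto_atTop.2 fun n => eventually_ge_atTop (ULift.up n)
  -- `|a - l| ⊔ |b - l|` bounds the modulus of every vector of `[a, b]` translated by `-l`.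
  have hz := H (|a - l| ⊔ |b - l|) ((abs_nonneg _).trans le_sup_left) κ
    (fun k => x (φ k).down - l) (fun k => abs_le_iff_mem_Icc.1 (sup_le ?_ ?_))
    (fun w hw f => by simpa using hu w hw f)
  · refine MapClusterPt.tendsto_subseq (MapClusterPt.of_comp (hdown.comp hφ)
      (Tendsto.mapClusterPt ?_))
    simpa [Function.comp_def] using hz.add_const l
  · exact (sub_le_sub_right (hx _).2 l).trans ((le_abs_self _).trans le_sup_right)
  · exact (neg_le_neg (sub_le_sub_right (hx _).1 l)).trans ((neg_le_abs _).trans le_sup_left)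

end NormedLattice

variable {E : Type u} [NormedAddCommGroup E] [NormedSpace ℝ E] [Lattice E]
  [IsOrderedAddMonoid E] [HasSolidNorm E]

/-- Disjoint sequences are uaw-null. -/
theorem uawTendsto_zero_of_disjoint {x : ℕ → E} (h : ∀ m n, m ≠ n → |x m| ⊓ |x n| = 0) :
    UAWTendsto x 0 := by
  intro w hw f
  set y : ℕ → E := fun n => |x n - 0| ⊓ w with hy
  have hy0 : ∀ n, 0 ≤ y n := fun n => le_inf (abs_nonneg _) hw
  have hyd : ∀ m n, m ≠ n → y m ⊓ y n = 0 := fun m n hmn =>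
    inf_eq_zero_of_le (hy0 m) (hy0 n) inf_le_left inf_le_left (by simpa using h m n hmn)
  have hs : Summable fun n => |f (y n)| := by
    refine summable_of_sum_le (c := ‖f‖ * ‖w‖) (fun n => abs_nonneg _) fun s => ?_
    -- Disjointness keeps every signed finite sum of the `y n` within `[-w, w]`, so `∑ |f (y n)|` is
    -- at most `‖f‖ * ‖w‖`.
    set σ : ℕ → ℝ := fun n => (SignType.sign (f (y n)) : ℝ)
    have hle : |∑ n ∈ s, σ n • y n| ≤ |w| := by
      rw [abs_of_nonneg hw]
      exact (abs_sum_le_sum_abs_of_lattice _ _).trans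
        ((Finset.sum_le_sum fun n _ => abs_sign_smul_le _ (hy0 n)).trans
          (sum_le_of_pairwise_inf_eq_zero hw hy0 (fun n => inf_le_right) hyd s))
    calc ∑ n ∈ s, |f (y n)| = f (∑ n ∈ s, σ n • y n) := by
          rw [map_sum]
          exact Finset.sum_congr rfl fun n _ => by
            rw [map_smul, smul_eq_mul, sign_mul_self]
      _ ≤ ‖f‖ * ‖∑ n ∈ s, σ n • y n‖ := (le_abs_self _).trans (f.le_opNorm _)
      _ ≤ ‖f‖ * ‖w‖ :=
          mul_le_mul_of_nonneg_left (norm_le_norm_of_abs_le_abs hle) (norm_nonneg f)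
  exact (tendsto_zero_iff_abs_tendsto_zero _).2 hs.tendsto_atTop_zero

end UnboundedAbsoluteWeak

/-! ### The equivalences -/

theorem corollary3p13 (E : Type u) [NormedAddCommGroup E] [NormedSpace ℝ E] [CompleteSpace E]
    [Lattice E] [IsOrderedAddMonoid E] [IsOrderedModule ℝ E] [HasSolidNorm E] :
    List.TFAE [
      IsOrderContinuousLattice E,
      ∀ S : Set E, IsCompact (closure S) → IsLWeaklyCompact S,
      ∀ v : E, 0 ≤ v → IsLwcOperator {v} (ContinuousLinearMap.id ℝ E),
      ∀ ε : ℝ, 0 < ε → ∀ v : E, 0 ≤ v →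
        ∃ g : StrongDual ℝ E, (∀ x : E, 0 ≤ x → 0 ≤ g x) ∧ ∃ w : E, 0 ≤ w ∧
          ∀ x ∈ Set.Icc (-v) v, ‖x‖ ≤ g (|x| ⊓ w) + ε,
      ∀ v : E, 0 ≤ v → ∀ (ι : Type u) [Preorder ι] [IsDirectedOrder ι] [Nonempty ι] (x : ι → E),
        (∀ i, x i ∈ Set.Icc (-v) v) → UAWTendsto x 0 → Tendsto x atTop (𝓝 0),
      ∀ v : E, 0 ≤ v → ∀ x : ℕ → E,
        (∀ n, x n ∈ Set.Icc (-v) v) → UAWTendsto x 0 → Tendsto x atTop (𝓝 0),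
      ∀ A : Set E, BddBelow A → BddAbove A → IsUAWCompact A → IsCompact A,
      ∀ A : Set E, BddBelow A → BddAbove A → IsRelativelyUAWCompact A →
        IsCompact (closure A)] := by
  have hbdd : ∀ (v : E) (x : ℕ → E), (∀ n, 0 ≤ x n) → (∀ n, x n ≤ v) →
      BddBelow (insert 0 (Set.range x)) ∧ BddAbove (insert 0 (Set.range x)) ∧
        Bornology.IsBounded (insert 0 (Set.range x)) := by
    intro v x h0 hv
    have h : ∀ y ∈ insert 0 (Set.range x), 0 ≤ y ∧ y ≤ v := by
      rintro y (rfl | ⟨n, rfl⟩)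
      · exact ⟨le_rfl, (h0 0).trans (hv 0)⟩
      · exact ⟨h0 n, hv n⟩
    exact ⟨⟨0, fun y hy => (h y hy).1⟩, ⟨v, fun y hy => (h y hy).2⟩,
      isBounded_iff_forall_norm_le.2 ⟨‖v‖, fun y hy =>
        norm_le_norm_of_nonneg_of_le (h y hy).1 (h y hy).2⟩⟩
  tfae_have 1 → 2 := fun H S hS => H.orderBoundedDisjointNull.isLWeaklyCompact hS
  tfae_have 2 → 4 := by
    intro H ε hε v hv
    have hD : OrderBoundedDisjointNull E := by
      intro v x h0 hv hd
      refine (H {v} (by simp)).2 x (fun n => ⟨v, rfl, ?_⟩) (disjoint_abs_of_disjoint h0 hd)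
      rw [abs_of_nonneg (h0 n)]
      exact (hv n).trans (le_abs_self v)
    obtain ⟨g, hg0, hg⟩ := hD.exists_norm_le_functional_add hε v
    refine ⟨g, hg0, v, hv, fun x hx => ?_⟩
    rw [inf_eq_left.2 (abs_le_iff_mem_Icc.2 hx), ← norm_abs_eq_norm x]
    exact hg _ (abs_nonneg x) (abs_le_iff_mem_Icc.2 hx)
  tfae_have 4 → 5 := by
    intro H v hv ι _ _ _ x hx hu
    refine hu.norm_tendsto_of_norm_le fun ε hε => ?_
    obtain ⟨g, -, w, hw, hg⟩ := H ε hε v hv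
    exact ⟨g, w, hw, fun i => hg _ (hx i)⟩
  tfae_have 5 → 7 := by
    rintro H A ⟨a, ha⟩ ⟨b, hb⟩ hA
    rw [isCompact_iff_isSeqCompact]
    intro x hx
    -- Nets are indexed in the universe of `E`, so the sequence is indexed by a lift of `ℕ`.
    obtain ⟨l, hl, hsub⟩ := hA.2 (ULift.{u} ℕ) (fun n => x n.down) fun n => hx _
    exact ⟨l, hl, hsub.exists_tendsto_subseq H fun n => ⟨ha (hx n), hb (hx n)⟩⟩
  tfae_have 5 → 8 := by
    rintro H A ⟨a, ha⟩ ⟨b, hb⟩ hA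
    rw [isCompact_iff_isSeqCompact]
    intro y hy
    -- The hypothesis concerns nets in `A`, so points of the closure are replaced by points of `A`
    -- at vanishing distance.
    have hex : ∀ n : ℕ, ∃ x ∈ A, dist (y n) x < 1 / ((n : ℝ) + 1) := fun n =>
      Metric.mem_closure_iff.1 (hy n) _ (by positivity)
    choose x hxA hxy using hex
    obtain ⟨l, hsub⟩ := hA.2 (ULift.{u} ℕ) (fun n => x n.down) fun n => hxA _
    obtain ⟨ψ, hψ, hlim⟩ := hsub.exists_tendsto_subseq H fun n => ⟨ha (hxA n), hb (hxA n)⟩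
    refine ⟨l, mem_closure_of_tendsto hlim (Eventually.of_forall fun n => hxA _), ψ, hψ, ?_⟩
    refine (tendsto_iff_of_dist ?_).2 hlim
    exact (squeeze_zero (fun n => dist_nonneg) (fun n => (hxy n).le)
      tendsto_one_div_add_atTop_nhds_zero_nat).comp hψ.tendsto_atTop
  tfae_have 8 → 1 := by
    intro H
    refine OrderBoundedDisjointNull.isOrderContinuousLattice fun v x h0 hv hd => ?_
    obtain ⟨h1, h2, h3⟩ := hbdd v x h0 hv
    exact tendsto_zero_of_disjoint_of_isCompact (H _ h1 h2 (isUAWCompact_insert_zero_range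
      (uawTendsto_zero_of_disjoint (disjoint_abs_of_disjoint h0 hd)) h3).isRelativelyUAWCompact)
      (fun n => subset_closure (Set.mem_insert_of_mem _ (Set.mem_range_self n))) hd
  tfae_have 7 → 1 := by
    intro H
    refine OrderBoundedDisjointNull.isOrderContinuousLattice fun v x h0 hv hd => ?_
    obtain ⟨h1, h2, h3⟩ := hbdd v x h0 hv
    exact tendsto_zero_of_disjoint_of_isCompact (H _ h1 h2 (isUAWCompact_insert_zero_range
      (uawTendsto_zero_of_disjoint (disjoint_abs_of_disjoint h0 hd)) h3))
      (fun n => Set.mem_insert_of_mem _ (Set.mem_range_self n)) hd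
  -- Condition 5 is stated for index types in `Type u`, which need not include `ℕ`; hence sequences
  -- are treated directly from 4.
  tfae_have 4 → 6 := by
    intro H v hv x hx hu
    refine hu.norm_tendsto_of_norm_le fun ε hε => ?_
    obtain ⟨g, -, w, hw, hg⟩ := H ε hε v hv
    exact ⟨g, w, hw, fun i => hg _ (hx i)⟩
  tfae_have 6 → 3 := by
    intro H v hv x hx hu
    refine H v hv x (fun n => ?_) hu
    obtain ⟨y, rfl, hy⟩ := hx n
    rw [abs_of_nonneg hv] at hy
    exact abs_le_iff_mem_Icc.1 hy
  tfae_have 3 → 1 := by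
    intro H
    refine OrderBoundedDisjointNull.isOrderContinuousLattice fun v x h0 hv hd => ?_
    refine H v ((h0 0).trans (hv 0)) x (fun n => ⟨v, rfl, ?_⟩)
      (uawTendsto_zero_of_disjoint (disjoint_abs_of_disjoint h0 hd))
    rw [abs_of_nonneg (h0 n)]
    exact (hv n).trans (le_abs_self v)
  tfae_finish
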